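/- **Theorem 3.8.** A tile is a cyclic arrangement of six colors on the edges of a regular hexagon. Let $T_2$ be the set of the 8 tiles with the (clockwise) color sequences $$bbrrrr,\ rrbbbb,\ brrbrr,\ rbbrbb,\ rbrrrb,\ brbbbr,\ bbbbbb,\ rrrrrr$$ over the colors red and blue, and let $T_3$ be the set of the 14 tiles with the color sequences $$yrrbby,\ ryybbr,\ yrrybb,\ ryyrbb,\ brrbyy,\ yrbybr,\ rbyryb,\ brybyr,\ brbyyr,\ bybrry,\ ryrbby,\ rbryyb,\ ybyrrb,\ yrybbr$$ over the colors red, yellow and blue. The points of $\mathbb{Z}^2$ are the cells of a hexagonal grid; the six neighbors of $x$, in clockwise order, are $x+(0,1)$, $x+(1,1)$, $x+(1,0)$, $x+(0,-1)$, $x+(-1,-1)$, $x+(-1,0)$. A shape function is a partial function $\mathcal{A}:\mathbb{Z}^2\to T_k$, with finite or infinite domain; it puts a tile at each point of its domain. A solution of $\mathcal{A}$ is a choice, for each point of the domain, of one of the six rotations of the tile there, such that any two neighboring tiles have the same color at their joint edge. For $k\in\{2,3\}$, Inf-$k$-TRP is the following decision problem. Instance: a Turing machine that computes a shape function $\mathcal{A}:\mathbb{Z}^2\to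 T_k$. Question: does $\mathcal{A}$ have a solution? Then both Inf-2-TRP and Inf-3-TRP are undecidable: for $k\in\{2,3\}$, the set of Turing machines that compute a shape function into $T_k$ with a solution is undecidable, and, moreover, no algorithm answers the question correctly on all Turing machines that compute a shape function into $T_k$ (its answers on other machines being arbitrary). This holds if the machines are required not to halt on points outside the domain of $\mathcal{A}$, and it also holds if they are required to halt on every point and to report that there is no tile on the points outside the domain. -/

import Mathlib

namespace Tantrix

/-! ### Tiles, arrangements, solutions -/

inductive Color
  | red | yellow | blue | green
  deriving DecidableEq

/-- A tile is given by its color sequence: the colors at its six edges, in clockwise order. -/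
abbrev Tile := Fin 6 → Color

open Color in
/-- The tile set `T₂` (colors red and blue). Up to rotation, these are all the color sequences of
tiles carrying three lines that are colored red or blue, each one once. -/
def tiles2 : Fin 8 → Tile := ![
  ![blue, blue, red, red, red, red],
  ![red, red, blue, blue, blue, blue],
  ![blue, red, red, blue, red, red],
  ![red, blue, blue, red, blue, blue],
  ![red, blue, red, red, red, blue],
  ![blue, red, blue, blue, blue, red],
  ![blue, blue, blue, blue, blue, blue],
  ![red, red, red, red, red, red]]

open Color in
/-- The tile set `T₃` (colors red, yellow and blue): the fourteen Tantrix tiles whose three lines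
have the three distinct colors red, yellow, blue. -/
def tiles3 : Fin 14 → Tile := ![
  ![yellow, red, red, blue, blue, yellow],
  ![red, yellow, yellow, blue, blue, red],
  ![yellow, red, red, yellow, blue, blue],
  ![red, yellow, yellow, red, blue, blue],
  ![blue, red, red, blue, yellow, yellow],
  ![yellow, red, blue, yellow, blue, red],
  ![red, blue, yellow, red, yellow, blue],
  ![blue, red, yellow, blue, yellow, red],
  ![blue, red, blue, yellow, yellow, red],
  ![blue, yellow, blue, red, red, yellow],
  ![red, yellow, red, blue, blue, yellow],
  ![red, blue, red, yellow, yellow, blue],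
  ![yellow, blue, yellow, red, red, blue],
  ![yellow, red, yellow, blue, blue, red]]

/-- The six neighbors of the origin in the hexagonal coordinate system on `ℤ²`, in clockwise
order. The edge number `d` of the tile at `x` is its joint edge with position `x + nbr d`, and that
edge has number `d + 3` for the tile at `x + nbr d`. -/
def nbr : Fin 6 → ℤ × ℤ := ![(0, 1), (1, 1), (1, 0), (0, -1), (-1, -1), (-1, 0)]

/-- The color at edge `d` of a tile that is rotated clockwise by `r` sixths of a full turn. -/
def edgeColor (t : Tile) (r d : Fin 6) : Color := t (d - r)

/-- A shape function over a tile set with `n` tiles: a partial function from `ℤ²` to (the indices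
of) the tiles. Its domain may be finite or infinite, and may have holes. -/
abbrev ShapeFunction (n : ℕ) := ℤ × ℤ → Option (Fin n)

/-- The rotations `r` solve the puzzle `A`: any two adjacent tiles match at their joint edge.
(The values of `r` outside the domain of `A` play no role.) -/
def IsSolution {n : ℕ} (T : Fin n → Tile) (A : ShapeFunction n) (r : ℤ × ℤ → Fin 6) : Prop :=
  ∀ (x : ℤ × ℤ) (d : Fin 6) (s t : Fin n), A x = some s → A (x + nbr d) = some t →
    edgeColor (T s) (r x) d = edgeColor (T t) (r (x + nbr d)) (d + 3)

def Solvable {n : ℕ} (T : Fin n → Tile) (A : ShapeFunction n) : Prop :=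
  ∃ r : ℤ × ℤ → Fin 6, IsSolution T A r

/-! ### Turing machines -/

/-- A (deterministic, one-tape) Turing machine, written down as a finite list of instructions
`((q, a), (q', i))`: in state `q`, scanning symbol `a`, perform `i` and go to state `q'`, where
`i = Sum.inl b` moves the head one cell (to the right if `b`, to the left otherwise) and
`i = Sum.inr c` writes the symbol `c` into the scanned cell. If several instructions have the same
`(q, a)`, then only the first one counts; if there is none, the machine halts. The states and the
symbols are natural numbers, `0` being the initial state and the blank symbol; only finitely many
of them occur in the list. -/
abbrev TM := List ((ℕ × ℕ) × (ℕ × (Bool ⊕ ℕ)))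

/-- The Turing machine with the given list of instructions, as a Mathlib Turing machine. -/
def TM.machine (M : TM) : Turing.TM0.Machine ℕ ℕ := fun q a =>
  (List.lookup (q, a) M).map fun p =>
    (p.1, p.2.elim
      (fun b => Turing.TM0.Stmt.move (if b then Turing.Dir.right else Turing.Dir.left))
      Turing.TM0.Stmt.write)

/-- The tape word for an integer: a separator `3`, then the binary digits, most significant first
and written as the symbols `1` (digit zero) and `2` (digit one), of the natural number `2m` for an
integer `m ≥ 0` and of `2|m| - 1` for an integer `m < 0`. -/
def intWord (m : ℤ) : List ℕ :=
  3 :: ((Nat.bits (Equiv.intEquivNat m)).reverse.map fun b => if b then 2 else 1)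

def inputWord (x : ℤ × ℤ) : List ℕ := intWord x.1 ++ intWord x.2

/-- The result of the machine on input `x`: it is started in state `0` on the first cell of the
input word, with blanks elsewhere on the tape, and the result is the symbol that is scanned when it
halts. The result is undefined if the machine does not halt. -/
def TM.result (M : TM) (x : ℤ × ℤ) : Part ℕ :=
  (Turing.TM0.eval M.machine (inputWord x)).map fun L => L.head

/-- The two usual ways for a machine to indicate that a partial function is undefined somewhere. -/
inductive Convention
  /-- The machine does not halt where the function is undefined. -/
  | diverge
  /-- The machine always halts, and scans a blank in the end where the function is undefined. -/
  | halt

/-- What a machine has to do at a position without a tile. -/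
def Convention.noTile : Convention → Part ℕ
  | .diverge => Part.none
  | .halt => Part.some 0

/-- The machine `M` computes the shape function `A`: where `A` has the tile of index `i : Fin n`
(that is, the tile number `i + 1`) it halts with the result `i + 1`, and where `A` is undefined it
behaves as the convention says. -/
def TM.Computes {n : ℕ} (c : Convention) (M : TM) (A : ShapeFunction n) : Prop :=
  ∀ x : ℤ × ℤ, M.result x = (A x).elim c.noTile fun i => Part.some (i.val + 1)

/-! ### The infinite rotation puzzle problem -/

/-- The instances over a tile set with `n` tiles: machines computing some shape function. -/
def IsInstance (n : ℕ) (c : Convention) (M : TM) : Prop :=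
  ∃ A : ShapeFunction n, M.Computes c A

/-- The infinite rotation puzzle problem for the tile set `T`: the machines that compute a shape
function whose rotation puzzle has a solution. -/
def InfTRP {n : ℕ} (T : Fin n → Tile) (c : Convention) (M : TM) : Prop :=
  ∃ A : ShapeFunction n, M.Computes c A ∧ Solvable T A

/-- Undecidability of the infinite rotation puzzle problem: the set of the yes-instances is not
decidable, and there is not even a decidable set of machines that contains all yes-instances
and none of the no-instances (so the reason is not just that instances cannot be recognized). -/
def InfTRPUndecidable {n : ℕ} (T : Fin n → Tile) (c : Convention) : Prop :=
  ¬ ComputablePred (InfTRP T c) ∧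
  ¬ ∃ D : TM → Prop, ComputablePred D ∧ ∀ M : TM, IsInstance n c M → (D M ↔ InfTRP T c M)

end Tantrix

namespace Tantrix

/-! The halting problem reduces to the puzzle. For a program number `e`, `haltingShape` fills every
line of constant first coordinate whose natural-number code is a sufficient bound for `e` to halt on
`0`, periodically with copies of an unsolvable rhombus. If `e` never halts, the shape is empty and
trivially solvable; if it halts, a complete rhombus occurs far out and no solution exists
(`solvable_haltingShape_iff`). Whether a position carries a tile is primitive recursive, so both
conventions are covered. Every machine built is a genuine instance, so the promise version follows,
and the plain version from it.

Most of the work is to produce, computably in `e`, a concrete instruction list for this shape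
(`exists_machine`). Only a prefix of the list depends on `e`: it writes `e` in unary before the
input. A fixed simulator then runs Mathlib's chain from partial recursive code through stack
machines to a one-tape machine, and a fixed suffix decodes the result. The parameter is passed as `2
^ e - 1` and a value `j` returned as `2 ^ j - 1`, because these have binary words of `e` and `j`
ones: unary notation passes through a binary interface. -/

open Turing StateTransition

/-! ### Lookup in association lists with distinct keys -/

section Lookup

variable {α κ β : Type*} [BEq κ] [LawfulBEq κ]

theorem lookup_map_of_mem (l : List α) (key : α → κ) (val : α → β)
    (hkey : ∀ x ∈ l, ∀ y ∈ l, key x = key y → x = y) {x : α} (hx : x ∈ l) :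
    (l.map fun y => (key y, val y)).lookup (key x) = some (val x) := by
  induction l with
  | nil => simp at hx
  | cons a l ih =>
    rw [List.map_cons, List.lookup_cons]
    by_cases h : key x = key a
    · obtain rfl := hkey _ hx _ List.mem_cons_self h
      simp
    · have hx' : x ∈ l := by
        rcases List.mem_cons.1 hx with rfl | hx'
        · exact absurd rfl h
        · exact hx'
      have hb : (key x == key a) = false := by simpa using h
      simp only [hb]
      exact ih (fun y hy z hz =>
        hkey _ (List.mem_cons_of_mem _ hy) _ (List.mem_cons_of_mem _ hz)) hx'

theorem lookup_map_eq_none (l : List α) (key : α → κ) (val : α → β) {k : κ}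
    (h : ∀ x ∈ l, key x ≠ k) : (l.map fun y => (key y, val y)).lookup k = none := by
  rw [List.lookup_eq_none_iff]
  simp only [List.mem_map, forall_exists_index, and_imp]
  rintro _ x hx rfl
  simpa using (h x hx).symm

end Lookup

/-! ### Single steps of a machine given by a list -/

section Steps

variable {M : TM} {q q' : ℕ} {T : Tape ℕ}

theorem step_left (h : M.lookup (q, T.head) = some (q', Sum.inl false)) :
    TM0.step M.machine ⟨q, T⟩ = some ⟨q', T.move Dir.left⟩ := by
  simp [TM0.step, TM.machine, h]

theorem step_right (h : M.lookup (q, T.head) = some (q', Sum.inl true)) :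
    TM0.step M.machine ⟨q, T⟩ = some ⟨q', T.move Dir.right⟩ := by
  simp [TM0.step, TM.machine, h]

theorem step_write {b : ℕ} (h : M.lookup (q, T.head) = some (q', Sum.inr b)) :
    TM0.step M.machine ⟨q, T⟩ = some ⟨q', T.write b⟩ := by
  simp [TM0.step, TM.machine, h]

theorem step_halt (h : M.lookup (q, T.head) = none) :
    TM0.step M.machine ⟨q, T⟩ = none := by
  simp [TM0.step, TM.machine, h]

end Steps

/-! ### Loading a number in unary -/

/-- The instructions that write `e` symbols `2` and then the symbol `b` to the left of a word
that consists of the symbols `2` and `3`, and pass into state `1`. -/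
def loader (b e : ℕ) : TM :=
  (List.range (e + 1)).map (fun i => ((2 * i, 3), (2 * i, Sum.inl false))) ++
  ((List.range (e + 1)).map (fun i => ((2 * i, 2), (2 * i, Sum.inl false))) ++
  (List.range (e + 1)).map
    (fun i => ((2 * i, 0), if i = e then (1, Sum.inr b) else (2 * (i + 1), Sum.inr 2))))

/-- The loader acts in even states only, so odd states are free for whatever is appended to it. -/
theorem loader_lookup_odd (b e : ℕ) {q : ℕ} (hq : q % 2 = 1) (a : ℕ) :
    (loader b e).lookup (q, a) = none := by
  simp only [loader, List.lookup_append, Option.or_eq_none_iff]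
  refine ⟨?_, ?_, ?_⟩ <;>
  · refine lookup_map_eq_none _ _ _ fun x _ h => ?_
    rw [Prod.mk.injEq] at h
    omega

theorem loader_lookup_of_mem (b e : ℕ) {i a : ℕ} (hi : i ≤ e) (ha : a = 2 ∨ a = 3) :
    (loader b e).lookup (2 * i, a) = some (2 * i, Sum.inl false) := by
  have hm : i ∈ List.range (e + 1) := by simp; omega
  have key (c : ℕ) : ∀ x ∈ List.range (e + 1), ∀ y ∈ List.range (e + 1),
      (2 * x, c) = (2 * y, c) → x = y := by
    intro x _ y _ h
    rw [Prod.mk.injEq] at h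
    omega
  simp only [loader, List.lookup_append]
  rcases ha with rfl | rfl
  · rw [lookup_map_eq_none _ (fun i => (2 * i, 3)), lookup_map_of_mem _ (fun i => (2 * i, 2)) _
      (key 2) hm]
    · rfl
    · simp
  · rw [lookup_map_of_mem _ (fun i => (2 * i, 3)) _ (key 3) hm]
    rfl

theorem loader_lookup_zero (b e : ℕ) {i : ℕ} (hi : i ≤ e) :
    (loader b e).lookup (2 * i, 0) =
      some (if i = e then (1, Sum.inr b) else (2 * (i + 1), Sum.inr 2)) := by
  have hm : i ∈ List.range (e + 1) := by simp; omega
  simp only [loader, List.lookup_append]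
  rw [lookup_map_eq_none _ (fun i => (2 * i, 3)), lookup_map_eq_none _ (fun i => (2 * i, 2)),
    lookup_map_of_mem _ (fun i => (2 * i, 0)) _ _ hm]
  · rfl
  · intro x _ y _ h
    rw [Prod.mk.injEq] at h
    omega
  · simp
  · simp

theorem mk₁_cons_move_left (a : ℕ) (l : List ℕ) :
    (Tape.mk₁ (a :: l)).move Dir.left = Tape.mk₁ (0 :: a :: l) := rfl

theorem mk₁_cons_write (a b : ℕ) (l : List ℕ) :
    (Tape.mk₁ (a :: l)).write b = Tape.mk₁ (b :: l) := rfl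

theorem loader_reaches (b e : ℕ) (L : TM) (l : List ℕ) :
    Reaches (TM0.step (TM.machine (loader b e ++ L))) ⟨0, Tape.mk₁ (3 :: l)⟩
      ⟨1, Tape.mk₁ (b :: (List.replicate e 2 ++ 3 :: l))⟩ := by
  have two_steps (i : ℕ) (hi : i ≤ e) :
      Reaches (TM0.step (TM.machine (loader b e ++ L)))
        ⟨2 * i, Tape.mk₁ (List.replicate i 2 ++ 3 :: l)⟩
        (if i = e then ⟨1, Tape.mk₁ (b :: (List.replicate i 2 ++ 3 :: l))⟩
          else ⟨2 * (i + 1), Tape.mk₁ (List.replicate (i + 1) 2 ++ 3 :: l)⟩) := by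
    -- The scanned symbol is never blank here, so one move left reaches a blank, which the second
    -- step overwrites.
    obtain ⟨a, l', ha, hl⟩ : ∃ a l', (a = 2 ∨ a = 3) ∧ List.replicate i 2 ++ 3 :: l = a :: l' := by
      cases i with
      | zero => exact ⟨3, l, Or.inr rfl, rfl⟩
      | succ i => exact ⟨2, _, Or.inl rfl, rfl⟩
    rw [List.replicate_succ, List.cons_append, hl]
    refine Relation.ReflTransGen.head (b := ⟨2 * i, Tape.mk₁ (0 :: a :: l')⟩) ?_
      (Relation.ReflTransGen.single ?_)
    · rw [← mk₁_cons_move_left]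
      refine step_left ?_
      rw [List.lookup_append]
      erw [loader_lookup_of_mem b e hi ha]
      rfl
    · have h0 := loader_lookup_zero b e hi
      split_ifs at h0 ⊢
      · rw [← mk₁_cons_write 0]
        refine step_write ?_
        rw [List.lookup_append]
        erw [h0]
        rfl
      · rw [← mk₁_cons_write 0]
        refine step_write ?_
        rw [List.lookup_append]
        erw [h0]
        rfl
  have all_steps (i : ℕ) (hi : i ≤ e) :
      Reaches (TM0.step (TM.machine (loader b e ++ L))) ⟨0, Tape.mk₁ (3 :: l)⟩
        ⟨2 * i, Tape.mk₁ (List.replicate i 2 ++ 3 :: l)⟩ := by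
    induction i with
    | zero => exact Relation.ReflTransGen.refl
    | succ i ih =>
      have h := two_steps i (by omega)
      rw [if_neg (by omega)] at h
      exact (ih (by omega)).trans h
  have h := two_steps e le_rfl
  rw [if_pos rfl] at h
  exact (all_steps e le_rfl).trans h

theorem computable_loader (b : ℕ) : Computable (loader b) := by
  have hr : Primrec fun e : ℕ => List.range (e + 1) := Primrec.list_range.comp Primrec.succ
  have hd : Primrec fun p : ℕ × ℕ => 2 * p.2 :=
    Primrec.nat_mul.comp (Primrec.const 2) Primrec.snd
  have hl (c : ℕ) : Primrec fun e : ℕ => (List.range (e + 1)).map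
      fun i => (((2 * i, c), (2 * i, Sum.inl false)) : (ℕ × ℕ) × (ℕ × (Bool ⊕ ℕ))) :=
    Primrec.list_map hr
      ((hd.pair (Primrec.const c)).pair (hd.pair (Primrec.const (Sum.inl false))))
  have hz : Primrec fun e : ℕ => (List.range (e + 1)).map
      fun i => (((2 * i, 0), if i = e then (1, Sum.inr b) else (2 * (i + 1), Sum.inr 2)) :
        (ℕ × ℕ) × (ℕ × (Bool ⊕ ℕ))) := by
    refine Primrec.list_map hr ((hd.pair (Primrec.const 0)).pair ?_)
    refine Primrec.ite (Primrec.eq.comp Primrec.snd Primrec.fst) (Primrec.const _) ?_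
    exact (Primrec.nat_mul.comp (Primrec.const 2) (Primrec.succ.comp Primrec.snd)).pair
      (Primrec.const (Sum.inr 2))
  exact (Primrec.list_append.comp (hl 3) (Primrec.list_append.comp (hl 2) hz)).to_comp

/-! ### A machine with finitely many states and symbols as a list -/

section Simulation

variable {Γ Λ : Type*} [Inhabited Γ] [Inhabited Λ]

/-- The symbol `b` and the state `q` of a machine are represented by the numbers `sy b` and `st q`.
Where the machine halts, the list goes on in state `3`. -/
def instruction (M : TM0.Machine Γ Λ) (st : Λ → ℕ) (sy : Γ → ℕ) (p : Λ × Γ) :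
    ℕ × (Bool ⊕ ℕ) :=
  match M p.1 p.2 with
  | some (q, TM0.Stmt.move Dir.left) => (st q, Sum.inl false)
  | some (q, TM0.Stmt.move Dir.right) => (st q, Sum.inl true)
  | some (q, TM0.Stmt.write b) => (st q, Sum.inr (sy b))
  | none => (3, Sum.inr (sy p.2))

noncomputable def simulator [Fintype Γ] (M : TM0.Machine Γ Λ) (S : Finset Λ) (st : Λ → ℕ)
    (sy : Γ → ℕ) : TM :=
  (S ×ˢ Finset.univ).toList.map fun p => ((st p.1, sy p.2), instruction M st sy p)

variable {M : TM0.Machine Γ Λ} {S : Finset Λ} {st : Λ → ℕ} {sy : PointedMap Γ ℕ}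

theorem simulator_lookup [Fintype Γ] (hst : Set.InjOn st S) (hsy : Function.Injective sy) {q : Λ}
    (hq : q ∈ S) (a : Γ) : (simulator M S st sy).lookup (st q, sy a) = some (instruction M st sy (q, a)) := by
  refine lookup_map_of_mem _ (fun p : Λ × Γ => (st p.1, sy p.2)) (instruction M st sy) ?_
    (x := (q, a)) (by simp [hq])
  rintro ⟨q₁, a₁⟩ h₁ ⟨q₂, a₂⟩ h₂ h
  simp only [Finset.mem_toList, Finset.mem_product, Finset.mem_univ, and_true] at h₁ h₂
  simp only [Prod.mk.injEq] at h ⊢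
  exact ⟨hst h₁ h₂ h.1, hsy h.2⟩

theorem simulator_lookup_eq_none [Fintype Γ] {k : ℕ × ℕ} (h : ∀ q, st q ≠ k.1) :
    (simulator M S st sy).lookup k = none :=
  lookup_map_eq_none _ _ _ fun x _ hx => h x.1 (congrArg Prod.fst hx)

/-- A list of instructions contains a simulator if it agrees with it on the states involved. -/
def Contains (R : TM) (M : TM0.Machine Γ Λ) (S : Finset Λ) (st : Λ → ℕ) (sy : Γ → ℕ) : Prop :=
  ∀ q ∈ S, ∀ a, R.lookup (st q, sy a) = some (instruction M st sy (q, a))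

variable {R : TM}

theorem Contains.step (hR : Contains R M S st sy) {c c' : TM0.Cfg Γ Λ} (hc : c.q ∈ S)
    (h : TM0.step M c = some c') :
    TM0.step R.machine (c.map sy st) = some (c'.map sy st) := by
  obtain ⟨q, T⟩ := c
  have hl := hR q hc T.head
  simp only [TM0.step, Option.map_eq_some_iff] at h
  obtain ⟨⟨q', s⟩, hM, rfl⟩ := h
  simp only [instruction, hM] at hl
  rw [← Tape.map_fst] at hl
  match s, hl with
  | TM0.Stmt.move Dir.left, hl =>
    simp only [TM0.Cfg.map, Tape.map_move]
    exact step_left hl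
  | TM0.Stmt.move Dir.right, hl =>
    simp only [TM0.Cfg.map, Tape.map_move]
    exact step_right hl
  | TM0.Stmt.write b, hl =>
    simp only [TM0.Cfg.map, Tape.map_write]
    exact step_write hl

/-- A state change must come with an action; rewriting the scanned symbol is one that leaves the
tape alone. -/
theorem Contains.step_halt (hR : Contains R M S st sy) {c : TM0.Cfg Γ Λ} (hc : c.q ∈ S)
    (h : TM0.step M c = none) :
    TM0.step R.machine (c.map sy st) = some ⟨3, c.Tape.map sy⟩ := by
  obtain ⟨q, T⟩ := c
  have hl := hR q hc T.head
  simp only [TM0.step, Option.map_eq_none_iff] at h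
  simp only [instruction, h] at hl
  rw [← Tape.map_fst] at hl
  simpa only [TM0.Cfg.map, Tape.write_self] using step_write hl

theorem Contains.reaches (hR : Contains R M S st sy) (hS : TM0.Supports M S) {c c' : TM0.Cfg Γ Λ}
    (hc : c.q ∈ S) (h : c' ∈ eval (TM0.step M) c) :
    Reaches (TM0.step R.machine) (c.map sy st) ⟨3, c'.Tape.map sy⟩ := by
  obtain ⟨hr, hn⟩ := mem_eval.1 h
  have key : c'.q ∈ S ∧ Reaches (TM0.step R.machine) (c.map sy st) (c'.map sy st) := by
    clear h hn
    induction hr with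
    | refl => exact ⟨hc, Relation.ReflTransGen.refl⟩
    | tail _ hs ih => exact ⟨TM0.step_supports M hS hs ih.1, ih.2.tail (hR.step ih.1 hs)⟩
  exact key.2.tail (hR.step_halt key.1 hn)

/-- Used in contrapositive form, to transfer divergence to the list. The induction runs along the
terminating computation of `R`, in which every step of `M` is matched by one step. -/
theorem Contains.dom (hR : Contains R M S st sy) (hS : TM0.Supports M S) {c : TM0.Cfg Γ Λ}
    (hc : c.q ∈ S) (h : (eval (TM0.step R.machine) (c.map sy st)).Dom) :
    (eval (TM0.step M) c).Dom := by
  obtain ⟨b, hb⟩ := Part.dom_iff_mem.1 h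
  generalize hd : c.map sy st = d at hb
  clear h
  revert c
  refine evalInduction (C := fun d => ∀ {c : TM0.Cfg Γ Λ}, c.q ∈ S → c.map sy st = d →
    (eval (TM0.step M) c).Dom) hb ?_
  intro d _ ih c hc hd
  rcases hs : TM0.step M c with _ | c'
  · exact Part.dom_iff_mem.2 ⟨c, mem_eval.2 ⟨Relation.ReflTransGen.refl, hs⟩⟩
  · have h1 := hR.step hc hs
    rw [hd] at h1
    have h2 := ih _ h1 (TM0.step_supports M hS hs hc) rfl
    rwa [reaches_eval (Relation.ReflTransGen.single hs)]

end Simulation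

/-! ### Reading off a number in unary -/

section Reader

variable {Γ : Type*} [Inhabited Γ] [Fintype Γ]

/-- The instructions that, from state `3`, walk to the right over the symbols satisfying `skip`
and then over `j ≤ N` further symbols up to the first one satisfying `isEnd`, and then write `j`. -/
noncomputable def reader (skip isEnd : Γ → Bool) (N : ℕ) (sy : Γ → ℕ) : TM :=
  (Finset.range (N + 1) ×ˢ (Finset.univ : Finset Γ)).toList.map fun p =>
    ((4 * p.1 + 3, sy p.2),
      if skip p.2 then (4 * p.1 + 3, Sum.inl true)
      else if isEnd p.2 then (4 * (N + 1) + 3, Sum.inr p.1)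
      else (4 * (p.1 + 1) + 3, Sum.inl true))

variable {skip isEnd : Γ → Bool} {N : ℕ} {sy : PointedMap Γ ℕ}

theorem reader_lookup (hsy : Function.Injective sy) {j : ℕ} (hj : j ≤ N) (a : Γ) :
    (reader skip isEnd N sy).lookup (4 * j + 3, sy a) = some
      (if skip a then (4 * j + 3, Sum.inl true)
      else if isEnd a then (4 * (N + 1) + 3, Sum.inr j)
      else (4 * (j + 1) + 3, Sum.inl true)) := by
  refine lookup_map_of_mem _ (fun p : ℕ × Γ => (4 * p.1 + 3, sy p.2)) (fun p =>
      if skip p.2 then (4 * p.1 + 3, Sum.inl true)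
      else if isEnd p.2 then (4 * (N + 1) + 3, Sum.inr p.1)
      else (4 * (p.1 + 1) + 3, Sum.inl true)) ?_ (x := (j, a)) (by simp; omega)
  rintro ⟨i₁, a₁⟩ - ⟨i₂, a₂⟩ - h
  simp only [Prod.mk.injEq] at h ⊢
  exact ⟨by omega, hsy h.2⟩

theorem reader_lookup_final (a : ℕ) :
    (reader skip isEnd N sy).lookup (4 * (N + 1) + 3, a) = none := by
  refine lookup_map_eq_none _ _ _ fun x hx h => ?_
  simp only [Finset.mem_toList, Finset.mem_product, Finset.mem_range] at hx
  rw [Prod.mk.injEq] at h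
  omega

variable {R : TM}

/-- The count is kept in the state, so a finite list suffices only because of the bound `N`. -/
theorem reader_eval (hsy : Function.Injective sy)
    (hR : ∀ j a, R.lookup (4 * j + 3, a) = (reader skip isEnd N sy).lookup (4 * j + 3, a))
    (T : Tape Γ) {j : ℕ} (hj : j ≤ N) (h0 : skip (T.nth 0) = true)
    (h1 : ∀ i : ℕ, i < j → skip (T.nth (i + 1)) = false ∧ isEnd (T.nth (i + 1)) = false)
    (h2 : skip (T.nth (j + 1)) = false ∧ isEnd (T.nth (j + 1)) = true) :
    ∃ c ∈ eval (TM0.step R.machine) ⟨3, T.map sy⟩, c.Tape.head = j := by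
  have hhead (i : ℕ) : ((Tape.move Dir.right)^[i] T).head = T.nth i := Tape.move_right_n_head T i
  have right_step (i q j' : ℕ) (hl : R.lookup (q, sy (T.nth i)) = some (j', Sum.inl true)) :
      TM0.step R.machine ⟨q, ((Tape.move Dir.right)^[i] T).map sy⟩ =
        some ⟨j', ((Tape.move Dir.right)^[i + 1] T).map sy⟩ := by
    rw [Function.iterate_succ_apply', Tape.map_move]
    refine step_right ?_
    rw [Tape.map_fst, hhead, hl]
  -- After `i + 1` moves only `i` symbols are counted, since cell `0` is skipped.
  have walk (i : ℕ) (hi : i ≤ j) : Reaches (TM0.step R.machine) ⟨3, T.map sy⟩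
      ⟨4 * i + 3, ((Tape.move Dir.right)^[i + 1] T).map sy⟩ := by
    induction i with
    | zero =>
      refine Relation.ReflTransGen.single (right_step 0 3 3 ?_)
      have := hR 0 (sy (T.nth 0))
      rw [reader_lookup hsy (Nat.zero_le N), if_pos h0] at this
      exact this
    | succ i ih =>
      refine (ih (by omega)).tail (right_step (i + 1) _ _ ?_)
      have h := h1 i (by omega)
      push_cast
      rw [hR, reader_lookup hsy (by omega), h.1, h.2]
      rfl
  refine ⟨⟨4 * (N + 1) + 3, (((Tape.move Dir.right)^[j + 1] T).map sy).write j⟩,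
    mem_eval.2 ⟨(walk j le_rfl).tail (step_write ?_), step_halt ?_⟩, rfl⟩
  · rw [Tape.map_fst, hhead]
    push_cast
    rw [hR, reader_lookup hsy hj, h2.1, h2.2]
    rfl
  · rw [hR, reader_lookup_final]

end Reader

/-! ### Symbols and words -/

theorem trNat_eq_map_bits (n : ℕ) : PartrecToTM2.trNat n =
    n.bits.map fun b => if b then PartrecToTM2.Γ'.bit1 else PartrecToTM2.Γ'.bit0 := by
  have pos (p : PosNum) : PartrecToTM2.trPosNum p =
      (p : ℕ).bits.map fun b => if b then PartrecToTM2.Γ'.bit1 else PartrecToTM2.Γ'.bit0 := by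
    induction p with
    | one => simp [PartrecToTM2.trPosNum]
    | bit1 p ih =>
      rw [PartrecToTM2.trPosNum, ih, PosNum.cast_bit1, ← two_mul, Nat.bit1_bits]
      simp
    | bit0 p ih =>
      have hp : (p : ℕ) ≠ 0 := (PosNum.cast_pos p).ne'
      rw [PartrecToTM2.trPosNum, ih, PosNum.cast_bit0, ← two_mul, Nat.bit0_bits _ hp]
      simp
  rw [PartrecToTM2.trNat]
  rcases h : (n : Num) with _ | p
  · have hn : n = 0 := by
      rw [← Num.to_of_nat n, h]
      rfl
    subst hn
    simp [PartrecToTM2.trNum]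
  · have hn : n = (p : ℕ) := by
      rw [← Num.to_of_nat n, h]
      rfl
    rw [hn]
    exact pos p

theorem bits_two_pow_sub_one (e : ℕ) : (2 ^ e - 1).bits = List.replicate e true := by
  induction e with
  | zero => simp
  | succ e ih =>
    have h : 2 ^ (e + 1) - 1 = 2 * (2 ^ e - 1) + 1 := by
      have := Nat.one_le_two_pow (n := e)
      omega
    rw [h, Nat.bit1_bits, ih, List.replicate_succ]

theorem trNat_two_pow_sub_one (e : ℕ) :
    PartrecToTM2.trNat (2 ^ e - 1) = List.replicate e PartrecToTM2.Γ'.bit1 := by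
  rw [trNat_eq_map_bits, bits_two_pow_sub_one, List.map_replicate]
  rfl

/-- The alphabet of the one-tape machine that simulates the stack machines of `PartrecToTM2`. -/
abbrev Symbol := TM2to1.Γ' PartrecToTM2.K' fun _ => PartrecToTM2.Γ'

/-- The symbol for an entry of the main stack. -/
def mainSymbol (bottom : Bool) (a : PartrecToTM2.Γ') : Symbol :=
  (bottom, Function.update (fun _ => none) PartrecToTM2.K'.main (some a))

theorem mainSymbol_injective {b b' : Bool} {a a' : PartrecToTM2.Γ'}
    (h : mainSymbol b a = mainSymbol b' a') : a = a' := by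
  have := congrFun (congrArg Prod.snd h) PartrecToTM2.K'.main
  simpa [mainSymbol] using this

theorem mainSymbol_ne_default (b : Bool) (a : PartrecToTM2.Γ') :
    mainSymbol b a ≠ (default : Symbol) := by
  intro h
  have := congrFun (congrArg Prod.snd h) PartrecToTM2.K'.main
  simp [mainSymbol, default] at this

instance : Fintype PartrecToTM2.K' :=
  ⟨{.main, .rev, .aux, .stack}, fun k => by cases k <;> decide⟩

open Classical in
/-- The tape symbols as numbers, such that the main stack is written as in `inputWord`. -/
noncomputable def symbolNumber (a : Symbol) : ℕ :=
  List.idxOf a (default :: mainSymbol false .bit0 :: mainSymbol false .bit1 ::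
    mainSymbol false .cons :: (Finset.univ : Finset Symbol).toList)

theorem symbolNumber_injective : Function.Injective symbolNumber := by
  classical
  intro a b h
  -- The list ends with all symbols, so each one occurs; repetitions do no harm because `idxOf`
  -- takes the first occurrence.
  exact (List.idxOf_inj (by simp)).1 h

theorem symbolNumber_default : symbolNumber default = 0 := by
  simp [symbolNumber]

theorem symbolNumber_bit0 : symbolNumber (mainSymbol false .bit0) = 1 := by
  simp [symbolNumber, (mainSymbol_ne_default _ _).symm]

theorem symbolNumber_bit1 : symbolNumber (mainSymbol false .bit1) = 2 := by
  have h : mainSymbol false .bit0 ≠ mainSymbol false .bit1 := fun h => by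
    simpa using mainSymbol_injective h
  simp [symbolNumber, (mainSymbol_ne_default _ _).symm, h]

theorem symbolNumber_cons : symbolNumber (mainSymbol false .cons) = 3 := by
  have h0 : mainSymbol false .bit0 ≠ mainSymbol false .cons := fun h => by
    simpa using mainSymbol_injective h
  have h1 : mainSymbol false .bit1 ≠ mainSymbol false .cons := fun h => by
    simpa using mainSymbol_injective h
  simp [symbolNumber, (mainSymbol_ne_default _ _).symm, h0, h1]

noncomputable def symbolMap : PointedMap Symbol ℕ := ⟨symbolNumber, symbolNumber_default⟩

theorem map_symbolNumber_trNat (n : ℕ) :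
    (PartrecToTM2.trNat n).reverse.map (fun a => symbolNumber (mainSymbol false a)) =
      n.bits.reverse.map fun b => if b then 2 else 1 := by
  rw [trNat_eq_map_bits, ← List.map_reverse, List.map_map]
  refine List.map_congr_left fun b _ => ?_
  cases b <;> simp [symbolNumber_bit0, symbolNumber_bit1]

/-- The numbers on the main stack for the position `x` and the parameter `e`. -/
def stackInput (e : ℕ) (x : ℤ × ℤ) : List ℕ :=
  [Equiv.intEquivNat x.2, Equiv.intEquivNat x.1, 2 ^ e - 1]

theorem trInit_of_reverse_eq {L t : List PartrecToTM2.Γ'} {a : PartrecToTM2.Γ'}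
    (h : L.reverse = a :: t) :
    TM2to1.trInit (Γ := fun _ => PartrecToTM2.Γ') PartrecToTM2.K'.main L =
      mainSymbol true a :: t.map (mainSymbol false) := by
  rw [TM2to1.trInit, h]
  rfl

/-- The tape shows the main stack from bottom to top, hence reversed: the terminator of each number
comes before its digits, most significant first, and serves as the separator `3`. This is why
`stackInput` lists the coordinates backwards, with the parameter last. Only the leftmost symbol
carries the bottom mark. -/
theorem map_trInit (e : ℕ) (x : ℤ × ℤ) :
    (TM2to1.trInit (Γ := fun _ => PartrecToTM2.Γ') PartrecToTM2.K'.main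
      (PartrecToTM2.trList (stackInput e x))).map symbolMap =
    symbolNumber (mainSymbol true .cons) :: (List.replicate e 2 ++ inputWord x) := by
  have h : (PartrecToTM2.trList (stackInput e x)).reverse = .cons ::
      ((PartrecToTM2.trNat (2 ^ e - 1)).reverse ++
        .cons :: ((PartrecToTM2.trNat (Equiv.intEquivNat x.1)).reverse ++
          .cons :: (PartrecToTM2.trNat (Equiv.intEquivNat x.2)).reverse)) := by
    simp [stackInput, PartrecToTM2.trList]
  have hf : (symbolMap : Symbol → ℕ) ∘ mainSymbol false =
      fun a => symbolNumber (mainSymbol false a) := rfl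
  rw [trInit_of_reverse_eq h, List.map_cons, List.map_map, hf]
  simp only [List.map_append, List.map_cons, map_symbolNumber_trNat, symbolNumber_cons,
    bits_two_pow_sub_one, List.reverse_replicate, List.map_replicate, if_true, inputWord, intWord,
    List.cons_append]
  rfl

/-! ### Machines for the computation of partial recursive functions -/

section StackMachine

open PartrecToTM2 (K')

variable {Λ : Type*} [Inhabited Λ]

/-- The one-tape machine for a stack machine. -/
noncomputable abbrev tapeMachine
    (m : Λ → TM2.Stmt (fun _ : K' => PartrecToTM2.Γ') Λ (Option PartrecToTM2.Γ')) :=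
  TM1to0.tr (TM2to1.tr m)

variable {m : Λ → TM2.Stmt (fun _ : K' => PartrecToTM2.Γ') Λ (Option PartrecToTM2.Γ')}

theorem tapeMachine_eval_dom (L : List PartrecToTM2.Γ') :
    (eval (TM0.step (tapeMachine m)) (TM0.init (TM2to1.trInit K'.main L))).Dom ↔
      (TM2.eval m K'.main L).Dom := by
  rw [← TM2to1.tr_eval_dom, ← TM1to0.tr_eval]
  rfl

/-- The simulating machine halts with its head on the bottom cell, so the output stack can be read
by walking right from there. -/
theorem tapeMachine_tape {L L' : List PartrecToTM2.Γ'} (h : L' ∈ TM2.eval m K'.main L) :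
    ∃ c ∈ eval (TM0.step (tapeMachine m)) (TM0.init (TM2to1.trInit K'.main L)),
      (c.Tape.nth 0).1 = true ∧ ∀ i : ℕ, (c.Tape.nth (i + 1)).1 = false ∧
        (c.Tape.nth (i + 1)).2 K'.main = L'.reverse[i + 1]? := by
  obtain ⟨c, hc⟩ := Part.dom_iff_mem.1
    ((tapeMachine_eval_dom (m := m) L).2 (Part.dom_iff_mem.2 ⟨_, h⟩))
  have h1 : c.Tape.right₀ ∈ TM1.eval (TM2to1.tr m) (TM2to1.trInit K'.main L) := by
    rw [← TM1to0.tr_eval]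
    exact Part.mem_map _ hc
  obtain ⟨S, B, hB, hS, hL⟩ := TM2to1.tr_eval m K'.main L h1 h
  refine ⟨c, hc, ?_, fun i => ⟨?_, ?_⟩⟩
  · have := TM2to1.addBottom_head_fst B
    rwa [hB, ← ListBlank.nth_zero, Tape.right₀_nth] at this
  · have := TM2to1.addBottom_nth_succ_fst B i
    rw [hB, Tape.right₀_nth] at this
    exact_mod_cast this
  · have h2 := TM2to1.addBottom_nth_snd B (i + 1)
    have h3 := TM2to1.stk_nth_val (i + 1) (hS K'.main)
    rw [hB, Tape.right₀_nth] at h2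
    rw [← h2, hL] at h3
    exact_mod_cast h3

/-- Concatenates loader, simulator and reader. Their instructions do not interfere, as their states
are even, `1` modulo `4` and `3` modulo `4`; control passes through states `1` and `3`. -/
theorem exists_machine_of_stackMachine {S : Finset Λ} (hS : TM2.Supports m S) (N : ℕ) :
    ∃ M : ℕ → TM, Computable M ∧ ∀ e x,
      (¬ (TM2.eval m K'.main (PartrecToTM2.trList (stackInput e x))).Dom →
        (M e).result x = Part.none) ∧
      ∀ j ≤ N, PartrecToTM2.trList [2 ^ j - 1] ∈
        TM2.eval m K'.main (PartrecToTM2.trList (stackInput e x)) →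
        (M e).result x = Part.some j := by
  classical
  set S₀ := TM1to0.trStmts (TM2to1.tr m) (TM2to1.trSupp m S)
  have hS' : TM0.Supports (tapeMachine m) S₀ := TM1to0.tr_supports _ (TM2to1.tr_supports m hS)
  -- Putting `default` in front gives the initial state the number `1`, where the loader exits.
  set st : TM1to0.Λ' (TM2to1.tr m) → ℕ := fun q => 4 * List.idxOf q (default :: S₀.toList) + 1
    with hst_def
  have hst : Set.InjOn st S₀ := by
    intro q hq q' _ h
    have h' : List.idxOf q (default :: S₀.toList) = List.idxOf q' (default :: S₀.toList) := by
      simp only [hst_def] at h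
      omega
    exact (List.idxOf_inj (List.mem_cons_of_mem _ (by simpa using hq))).1 h'
  have hst_default : st default = 1 := by simp [hst_def]
  have hsy : Function.Injective symbolMap := symbolNumber_injective
  set b := symbolNumber (mainSymbol true .cons)
  set sim : TM := simulator (tapeMachine m) S₀ st symbolMap
  set rd : TM := reader (fun a : Symbol => a.1) (fun a => (a.2 K'.main).isNone) N symbolMap
  set M : ℕ → TM := fun e => loader b e ++ (sim ++ rd)
  have hsim (e : ℕ) : Contains (M e) (tapeMachine m) S₀ st symbolMap := by
    intro q hq a
    simp only [M, List.lookup_append]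
    rw [loader_lookup_odd _ _ (by simp only [hst_def]; omega), simulator_lookup hst hsy hq]
    rfl
  have hrd (e j a : ℕ) : (M e).lookup (4 * j + 3, a) = rd.lookup (4 * j + 3, a) := by
    simp only [M, List.lookup_append]
    rw [loader_lookup_odd _ _ (by omega), simulator_lookup_eq_none]
    · rfl
    · intro q
      simp only [hst_def]
      omega
  have hload (e : ℕ) (x : ℤ × ℤ) : eval (TM0.step (M e).machine) (TM0.init (inputWord x)) =
      eval (TM0.step (M e).machine) ((TM0.init (TM2to1.trInit K'.main
        (PartrecToTM2.trList (stackInput e x)))).map symbolMap st) := by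
    have h : (TM0.init (TM2to1.trInit K'.main (PartrecToTM2.trList (stackInput e x)))).map
        symbolMap st = ⟨1, Tape.mk₁ (b :: (List.replicate e 2 ++ inputWord x))⟩ := by
      rw [← map_trInit, ← Tape.map_mk₁, ← hst_default]
      rfl
    rw [h]
    exact reaches_eval (loader_reaches b e (sim ++ rd) _)
  refine ⟨M, ?_, fun e x => ⟨fun hd => ?_, fun j hj h => ?_⟩⟩
  · exact Computable.list_append.comp (computable_loader b) (Computable.const _)
  · rw [TM.result, TM0.eval, hload, Part.eq_none_iff'.2
      fun h => hd ((tapeMachine_eval_dom _).1 ((hsim e).dom hS' hS'.1 h)), Part.map_none,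
      Part.map_none]
  · obtain ⟨c, hc, h0, hn⟩ := tapeMachine_tape h
    -- Entry `0` is the terminator, on the bottom cell; the `j` ones follow it.
    have hl (i : ℕ) : (PartrecToTM2.trList [2 ^ j - 1]).reverse[i + 1]? =
        if i < j then some .bit1 else none := by
      simp [PartrecToTM2.trList, trNat_two_pow_sub_one, List.getElem?_replicate]
    obtain ⟨c', hc', hj'⟩ := reader_eval (R := M e) hsy (hrd e) c.Tape hj h0
      (fun i hi => ⟨(hn i).1, by rw [(hn i).2, hl, if_pos hi]; rfl⟩)
      ⟨(hn j).1, by rw [(hn j).2, hl, if_neg (lt_irrefl j)]; rfl⟩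
    rw [TM.result, TM0.eval, hload, reaches_eval ((hsim e).reaches hS' hS'.1 hc),
      Part.eq_some_iff.2 hc', Part.map_some, Part.map_some, ← hj', Tape.right₀,
      ListBlank.head_cons]

end StackMachine

/-- A partial recursive function with values at most `N` is computed by Turing machines that have
its last argument `2 ^ e - 1` built in and take the other two from the position. -/
theorem exists_machine {f : List.Vector ℕ 3 →. ℕ} (hf : Partrec f) {N : ℕ}
    (hN : ∀ v, ∀ j ∈ f v, j ≤ N) :
    ∃ M : ℕ → TM, Computable M ∧ ∀ e x, (M e).result x = f ⟨stackInput e x, rfl⟩ := by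
  have hg : Partrec fun v => (f v).map fun j => 2 ^ j - 1 := by
    have hp : Primrec₂ fun (_ : List.Vector ℕ 3) (j : ℕ) => 2 ^ j - 1 :=
      Primrec.nat_sub.comp
        ((Primrec₂.unpaired'.1 Nat.Primrec.pow).comp (Primrec.const 2) Primrec.snd)
        (Primrec.const 1)
    exact hf.map hp.to_comp
  obtain ⟨c, hc⟩ := ToPartrec.Code.exists_code (Nat.Partrec'.part_iff.2 hg)
  -- The default element is the initial state of a stack machine, so this instance selects the
  -- program `c`.
  let _ : Inhabited PartrecToTM2.Λ' := ⟨PartrecToTM2.trNormal c .halt⟩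
  obtain ⟨M, hM, h⟩ := exists_machine_of_stackMachine (PartrecToTM2.tr_supports c .halt) N
  have hinit (v : List ℕ) : TM2.init PartrecToTM2.K'.main (PartrecToTM2.trList v) =
      PartrecToTM2.init c v := by
    simp only [TM2.init, PartrecToTM2.init]
    congr 1
    funext k
    cases k <;> rfl
  have heval (v : List ℕ) : TM2.eval PartrecToTM2.tr PartrecToTM2.K'.main
      (PartrecToTM2.trList v) = (c.eval v).map PartrecToTM2.trList := by
    unfold TM2.eval
    rw [hinit, PartrecToTM2.tr_eval]
    exact Part.map_map _ _ _
  refine ⟨M, hM, fun e x => ?_⟩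
  have hcv := hc ⟨stackInput e x, rfl⟩
  obtain ⟨h1, h2⟩ := h e x
  rw [heval, hcv] at h1 h2
  rcases Part.eq_none_or_eq_some (f ⟨stackInput e x, rfl⟩) with hv | ⟨j, hv⟩
  · rw [hv]
    refine h1 ?_
    rw [hv]
    simp
  · rw [hv]
    refine h2 j (hN _ j (Part.eq_some_iff.1 hv)) ?_
    rw [hv]
    simp [pure]

open Nat.Partrec (Code)

/-! ### Puzzles on four positions -/

/-- The rhombus with the tiles `t i j` at the positions `(i, j)`, `i, j ∈ {0, 1}`, cannot be
solved. -/
def Unsolvable {n : ℕ} (T : Fin n → Tile) (t : Bool → Bool → Fin n) : Prop :=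
  ∀ r₀₀ r₁₀ : Fin 6,
    edgeColor (T (t false false)) r₀₀ 2 = edgeColor (T (t true false)) r₁₀ 5 → ∀ r₁₁ : Fin 6,
    edgeColor (T (t false false)) r₀₀ 1 = edgeColor (T (t true true)) r₁₁ 4 →
    edgeColor (T (t true false)) r₁₀ 0 = edgeColor (T (t true true)) r₁₁ 3 → ∀ r₀₁ : Fin 6,
    edgeColor (T (t false false)) r₀₀ 0 = edgeColor (T (t false true)) r₀₁ 3 →
    ¬ edgeColor (T (t false true)) r₀₁ 2 = edgeColor (T (t true true)) r₁₁ 5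

theorem Unsolvable.not_solvable {n : ℕ} {T : Fin n → Tile} {t : Bool → Bool → Fin n}
    (h : Unsolvable T t) {A : ShapeFunction n} (x y : ℤ)
    (h₀₀ : A (x, y) = some (t false false)) (h₁₀ : A (x + 1, y) = some (t true false))
    (h₀₁ : A (x, y + 1) = some (t false true)) (h₁₁ : A (x + 1, y + 1) = some (t true true)) :
    ¬ Solvable T A := by
  rintro ⟨r, hr⟩
  have e₁ := hr (x, y) 2 _ _ h₀₀ (by simpa [nbr] using h₁₀)
  have e₂ := hr (x, y) 1 _ _ h₀₀ (by simpa [nbr] using h₁₁)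
  have e₃ := hr (x + 1, y) 0 _ _ h₁₀ (by simpa [nbr] using h₁₁)
  have e₄ := hr (x, y) 0 _ _ h₀₀ (by simpa [nbr] using h₀₁)
  have e₅ := hr (x, y + 1) 2 _ _ h₀₁ (by simpa [nbr] using h₁₁)
  have n₁ : (x, y) + nbr 2 = (x + 1, y) := by simp [nbr]
  have n₂ : (x, y) + nbr 1 = (x + 1, y + 1) := by simp [nbr]
  have n₃ : (x + 1, y) + nbr 0 = (x + 1, y + 1) := by simp [nbr]
  have n₄ : (x, y) + nbr 0 = (x, y + 1) := by simp [nbr]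
  have n₅ : (x, y + 1) + nbr 2 = (x + 1, y + 1) := by simp [nbr]
  rw [n₁] at e₁
  rw [n₂] at e₂
  rw [n₃] at e₃
  rw [n₄] at e₄
  rw [n₅] at e₅
  exact h _ _ e₁ _ e₂ e₃ _ e₄ e₅

theorem solvable_of_eq_none {n : ℕ} (T : Fin n → Tile) {A : ShapeFunction n}
    (h : ∀ x, A x = none) : Solvable T A :=
  ⟨fun _ => 0, fun x _ s _ hs => by simp [h x] at hs⟩

/-- An unsolvable rhombus of tiles from `T₂`: a blue tile next to a red one. -/
def rhombus2 (i _j : Bool) : Fin 8 := cond i 7 6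

/-- An unsolvable rhombus of tiles from `T₃`. -/
def rhombus3 (i j : Bool) : Fin 14 := cond i (cond j 4 2) (cond j 3 0)

theorem unsolvable_rhombus2 : Unsolvable tiles2 rhombus2 := by
  unfold Unsolvable
  -- The pair of tiles at `(0, 0)` and `(1, 0)` already fails: monochromatic tiles of different
  -- colors never match.
  decide

-- Each tile of `tiles3` shows all three colors, so two neighbors can always be matched and a larger
-- obstruction is needed. It is verified by exhaustion; `Unsolvable` interleaves the edge conditions
-- with the quantifiers so that failing branches are cut early.
set_option maxRecDepth 10000 in
theorem unsolvable_rhombus3 : Unsolvable tiles3 rhombus3 := by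
  unfold Unsolvable
  decide

/-! ### Shape functions that depend on the halting of a program -/

/-- This is `e` for `w = 2 ^ e - 1`. -/
def exponent (w : ℕ) : ℕ := Nat.findGreatest (fun e => 2 ^ e ≤ w + 1) w

theorem exponent_two_pow_sub_one (e : ℕ) : exponent (2 ^ e - 1) = e := by
  have h1 : 2 ^ e - 1 + 1 = 2 ^ e := Nat.sub_add_cancel Nat.one_le_two_pow
  have h2 : e < 2 ^ e := Nat.lt_two_pow_self
  rw [exponent, Nat.findGreatest_eq_iff]
  refine ⟨by omega, fun _ => h1.ge, fun k hk _ h => ?_⟩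
  rw [h1] at h
  exact absurd ((Nat.pow_le_pow_iff_right (by norm_num)).1 h) (by omega)

theorem primrec_exponent : Primrec exponent := by
  refine Primrec.nat_findGreatest Primrec.id ?_
  exact Primrec.nat_le.comp
    ((Primrec₂.unpaired'.1 Nat.Primrec.pow).comp (Primrec.const 2) Primrec.snd)
    (Primrec.succ.comp Primrec.fst)

/-- The program number `e` halts on `0` within the bound `k`. -/
def haltsWithin (e k : ℕ) : Bool := ((Denumerable.ofNat Code e).evaln k 0).isSome

theorem haltsWithin_mono {e k l : ℕ} (hkl : k ≤ l) (h : haltsWithin e k) : haltsWithin e l := by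
  obtain ⟨x, hx⟩ := Option.isSome_iff_exists.1 h
  exact Option.isSome_iff_exists.2 ⟨x, Code.evaln_mono hkl hx⟩

theorem dom_iff_exists_haltsWithin (c : Code) :
    (c.eval 0).Dom ↔ ∃ k, haltsWithin (Encodable.encode c) k := by
  simp only [haltsWithin, Denumerable.ofNat_encode, Option.isSome_iff_exists, Part.dom_iff_mem]
  constructor
  · rintro ⟨x, hx⟩
    obtain ⟨k, hk⟩ := Code.evaln_complete.1 hx
    exact ⟨k, x, hk⟩
  · rintro ⟨k, x, hk⟩
    exact ⟨x, Code.evaln_sound hk⟩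

variable {n : ℕ}

/-- The tile for the position with the natural numbers `a` and `b` as coordinates. -/
def haltingTile (t : Bool → Bool → Fin n) (e a b : ℕ) : Option (Fin n) :=
  if haltsWithin e a then some (t a.div2.bodd b.div2.bodd) else none

/-- The shape function that has no tiles if the program number `e` does not halt, and contains
copies of the rhombus `t` if it does. -/
def haltingShape (t : Bool → Bool → Fin n) (e : ℕ) : ShapeFunction n := fun x =>
  haltingTile t e (Equiv.intEquivNat x.1) (Equiv.intEquivNat x.2)

theorem intEquivNat_natCast (m : ℕ) : Equiv.intEquivNat (m : ℤ) = 2 * m := rfl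

theorem haltingShape_natCast (t : Bool → Bool → Fin n) {e k : ℕ} (h : haltsWithin e k) (i j : ℕ)
    (hi : k ≤ i) : haltingShape t e (i, j) = some (t i.bodd j.bodd) := by
  have hd (m : ℕ) : (2 * m).div2 = m := by
    rw [Nat.div2_val]
    omega
  rw [haltingShape, haltingTile, intEquivNat_natCast, intEquivNat_natCast,
    if_pos (haltsWithin_mono (by omega) h), hd, hd]

/-- At nonnegative coordinates the tile is chosen by their parities, so beyond a halting bound `k` a
full rhombus starts at `(2 * k, 0)`, the even coordinate making its corners line up. -/
theorem solvable_haltingShape_iff {T : Fin n → Tile} {t : Bool → Bool → Fin n}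
    (ht : Unsolvable T t) (e : ℕ) :
    Solvable T (haltingShape t e) ↔ ¬ ∃ k, haltsWithin e k := by
  constructor
  · rintro hs ⟨k, hk⟩
    have h (i j : ℕ) (hi : k ≤ i) := haltingShape_natCast t hk i j hi
    have hb : (2 * k).bodd = false := by simp
    have hb' : (2 * k + 1).bodd = true := by simp
    refine ht.not_solvable (2 * k : ℕ) (0 : ℕ) ?_ ?_ ?_ ?_ hs
    · rw [h _ _ (by omega), hb, Nat.bodd_zero]
    · have := h (2 * k + 1) 0 (by omega)
      rw [hb', Nat.bodd_zero] at this
      exact_mod_cast this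
    · have := h (2 * k) 1 (by omega)
      rw [hb, Nat.bodd_one] at this
      exact_mod_cast this
    · have := h (2 * k + 1) 1 (by omega)
      rw [hb', Nat.bodd_one] at this
      exact_mod_cast this
  · intro hn
    refine solvable_of_eq_none T fun x => ?_
    rw [haltingShape, haltingTile, if_neg fun hk => hn ⟨_, hk⟩]

theorem primrec_haltingTile (t : Bool → Bool → Fin n) :
    Primrec fun v : List.Vector ℕ 3 => haltingTile t (exponent (v.get 2)) (v.get 1) (v.get 0) := by
  have hg (i : Fin 3) : Primrec fun v : List.Vector ℕ 3 => v.get i :=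
    Primrec.vector_get.comp Primrec.id (Primrec.const i)
  have hb (i : Fin 3) : Primrec fun v : List.Vector ℕ 3 => (v.get i).div2.bodd :=
    Primrec.nat_bodd.comp (Primrec.nat_div2.comp (hg i))
  have hh : Primrec fun v : List.Vector ℕ 3 => haltsWithin (exponent (v.get 2)) (v.get 1) :=
    Primrec.option_isSome.comp (Code.primrec_evaln.comp
      (((hg 1).pair ((Primrec.ofNat Code).comp (primrec_exponent.comp (hg 2)))).pair
        (Primrec.const 0)))
  have ht : Primrec fun p : Bool × Bool => some (t p.1 p.2) := Primrec.dom_finite _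
  exact Primrec.ite (Primrec.eq.comp hh (Primrec.const true)) (ht.comp ((hb 1).pair (hb 0)))
    (Primrec.const none)

/-! ### Output conventions and the reduction from the halting problem -/

/-- The result that a machine has to give for a tile or no tile, under a convention. -/
def Convention.output (c : Convention) (s : Option (Fin n)) : Part ℕ :=
  s.elim c.noTile fun i => Part.some (i.val + 1)

/-- Since `f` is total and decides whether there is a tile, absence can be turned into divergence or
into the value `0` alike. -/
theorem Convention.partrec_output {α : Type*} [Primcodable α] (c : Convention)
    {f : α → Option (Fin n)} (hf : Primrec f) : Partrec fun a => c.output (f a) := by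
  have hs : Primrec fun s : Option (Fin n) => s.map fun i => i.val + 1 := Primrec.dom_finite _
  cases c with
  | diverge =>
    refine (hs.comp hf).to_comp.ofOption.of_eq fun a => ?_
    cases f a <;> rfl
  | halt =>
    have hd := (Primrec.option_getD.comp (hs.comp hf) (Primrec.const 0)).to_comp.partrec
    refine hd.of_eq fun a => ?_
    simp only [PFun.coe_val]
    cases f a <;> rfl

theorem Convention.le_of_mem_output (c : Convention) (s : Option (Fin n)) {j : ℕ}
    (hj : j ∈ c.output s) : j ≤ n := by
  cases s with
  | some i =>
    obtain rfl := Part.mem_some_iff.1 hj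
    exact i.2
  | none =>
    cases c with
    | diverge => exact absurd hj (Part.notMem_none j)
    | halt =>
      obtain rfl := Part.mem_some_iff.1 hj
      exact Nat.zero_le n

theorem exists_machine_haltingShape (c : Convention) (t : Bool → Bool → Fin n) :
    ∃ M : ℕ → TM, Computable M ∧ ∀ e, (M e).Computes c (haltingShape t e) := by
  obtain ⟨M, hM, h⟩ := exists_machine (c.partrec_output (primrec_haltingTile t))
    fun v j hj => c.le_of_mem_output _ hj
  refine ⟨M, hM, fun e x => ?_⟩
  rw [h e x]
  have he : exponent (List.Vector.get (⟨stackInput e x, rfl⟩ : List.Vector ℕ 3) 2) = e :=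
    exponent_two_pow_sub_one e
  rw [he]
  rfl

/-- Tile results are positive, so they never collide with the blank. Hence a machine determines its
shape function, and the existential in `InfTRP` ranges over at most one shape. -/
theorem Convention.output_injective (c : Convention) :
    Function.Injective (c.output : Option (Fin n) → Part ℕ) := by
  intro s s' h
  cases c <;> cases s <;> cases s' <;>
    simp_all [Convention.output, Convention.noTile, Part.some_inj, Fin.ext_iff, eq_comm]

theorem TM.Computes.unique {c : Convention} {M : TM} {A B : ShapeFunction n}
    (hA : M.Computes c A) (hB : M.Computes c B) : A = B :=
  funext fun x => c.output_injective ((hA x).symm.trans (hB x))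

theorem infTRPUndecidable_of_unsolvable {T : Fin n → Tile} {t : Bool → Bool → Fin n}
    (ht : Unsolvable T t) (c : Convention) : InfTRPUndecidable T c := by
  have hsep : ¬ ∃ D : TM → Prop, ComputablePred D ∧
      ∀ M : TM, IsInstance n c M → (D M ↔ InfTRP T c M) := by
    rintro ⟨D, hD, h⟩
    obtain ⟨M, hM, hA⟩ := exists_machine_haltingShape c t
    -- Halting corresponds to an unsolvable puzzle, so the reduction goes to the complement of `D`.
    refine ComputablePred.halting_problem 0 (ComputablePred.computable_of_manyOneReducible
      (q := fun L => ¬ D L) ⟨fun d => M (Encodable.encode d), hM.comp Computable.encode,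
        fun d => ?_⟩ hD.not)
    change (d.eval 0).Dom ↔ ¬ D (M (Encodable.encode d))
    rw [h _ ⟨_, hA _⟩, dom_iff_exists_haltsWithin, ← not_iff_not, not_not,
      ← solvable_haltingShape_iff ht]
    constructor
    · exact fun hs => ⟨_, hA _, hs⟩
    · rintro ⟨A, hA', hs⟩
      rwa [(hA _).unique hA']
  -- If `InfTRP T c` were decidable, it would itself serve as `D`.
  exact ⟨fun h => hsep ⟨_, h, fun _ _ => Iff.rfl⟩, hsep⟩

end Tantrix

/-- The infinite rotation puzzle problems with two and with three colors are undecidable, under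
either convention for the representation of partial shape functions by Turing machines. -/
theorem theorem3p8 :
    (∀ c : Tantrix.Convention, Tantrix.InfTRPUndecidable Tantrix.tiles2 c) ∧
    (∀ c : Tantrix.Convention, Tantrix.InfTRPUndecidable Tantrix.tiles3 c) :=
  ⟨Tantrix.infTRPUndecidable_of_unsolvable Tantrix.unsolvable_rhombus2,
    Tantrix.infTRPUndecidable_of_unsolvable Tantrix.unsolvable_rhombus3⟩
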